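/- Let $R$ be a commutative Noetherian local ring that is Gorenstein (it has finite injective dimension as a module over itself) and has the Krull-Remak-Schmidt property: whenever $\bigoplus_{i=1}^m M_i \cong \bigoplus_{j=1}^n N_j$ with all $M_i, N_j$ nonzero, finitely generated and indecomposable $R$-modules, then $m=n$ and, after renumbering, $M_i\cong N_i$ for each $i$. Let $J(R)$ be the quotient of the free $\mathbb{Z}[t^{\pm1}]$-module on the isomorphism classes $[M]$ of finitely generated $R$-modules by the submodule generated by the elements * $[M]-[M']$ for every exact sequence $0\to P\to M\to M'\to 0$ of finitely generated $R$-modules with $P$ projective; * $[M]-t[M']$ for every exact sequence $0\to M'\to P\to M\to 0$ of finitely generated $R$-modules with $P$ projective; * $[M\oplus M']-[M]-[M']$ for all finitely generated $R$-modules $M$ and $M'$. An element $u\in J(R)$ is called torsion if $ru=0$ for some nonzero $r\in\mathbb{Z}[t^{\pm1}]$. Then: 1. An element $u\in J(R)$ is torsion if and only if there exists an integer $n\ge 1$ such that $(t^n-1)u=0$. 2. $J(R)$ has a nonzero torsion element if and only if there is a finitely generated $R$-module $M$ whose class $[M]$ is a nonzero torsion element of $J(R)$. -/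

import Mathlib

open scoped LaurentPolynomial

universe u

namespace GrothendieckModule

section Classes

variable (R : Type u) [CommRing R]

/-- The isomorphism classes of finitely generated `R`-modules. -/
abbrev FGClass : Type (u + 1) :=
  Quotient (CategoryTheory.isIsomorphicSetoid (FGModuleCat.{u} R))

/-- The free `ℤ[t, t⁻¹]`-module on the isomorphism classes of finitely generated `R`-modules. -/
abbrev FreeOnClasses : Type (u + 1) :=
  FGClass R →₀ ℤ[T;T⁻¹]

/-- The basis element of the free module given by the isomorphism class of `M`. -/
noncomputable def basisElt (M : Type u) [AddCommGroup M] [Module R M] [Module.Finite R M] :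
    FreeOnClasses R :=
  Finsupp.single (Quotient.mk _ (FGModuleCat.of R M)) 1

/-- The elements of the free module that generate the submodule of relations. All modules are
finitely generated, and `t` is `LaurentPolynomial.T 1`. -/
inductive Relator : FreeOnClasses R → Prop
  /-- `[M] - [M']` for every exact sequence `0 → P → M → M' → 0` with `P` projective. -/
  | projSub (P M M' : Type u)
      [AddCommGroup P] [Module R P] [Module.Finite R P] [Module.Projective R P]
      [AddCommGroup M] [Module R M] [Module.Finite R M]
      [AddCommGroup M'] [Module R M'] [Module.Finite R M']
      (f : P →ₗ[R] M) (g : M →ₗ[R] M') (hf : Function.Injective f)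
      (hfg : Function.Exact f g) (hg : Function.Surjective g) :
      Relator (basisElt R M - basisElt R M')
  /-- `[M] - t [M']` for every exact sequence `0 → M' → P → M → 0` with `P` projective. -/
  | syzygy (M' P M : Type u)
      [AddCommGroup M'] [Module R M'] [Module.Finite R M']
      [AddCommGroup P] [Module R P] [Module.Finite R P] [Module.Projective R P]
      [AddCommGroup M] [Module R M] [Module.Finite R M]
      (f : M' →ₗ[R] P) (g : P →ₗ[R] M) (hf : Function.Injective f)
      (hfg : Function.Exact f g) (hg : Function.Surjective g) :
      Relator (basisElt R M - (LaurentPolynomial.T 1 : ℤ[T;T⁻¹]) • basisElt R M')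
  /-- `[M ⊕ M'] - [M] - [M']`. -/
  | directSum (M M' : Type u)
      [AddCommGroup M] [Module R M] [Module.Finite R M]
      [AddCommGroup M'] [Module R M'] [Module.Finite R M'] :
      Relator (basisElt R (M × M') - basisElt R M - basisElt R M')

/-- The `ℤ[t, t⁻¹]`-submodule generated by the relations. -/
noncomputable def relations : Submodule ℤ[T;T⁻¹] (FreeOnClasses R) :=
  Submodule.span ℤ[T;T⁻¹] {x | Relator R x}

/-- The `ℤ[t, t⁻¹]`-module `J(R)`. -/
abbrev J : Type (u + 1) :=
  FreeOnClasses R ⧸ relations R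

/-- The class `[M]` in `J(R)` of a finitely generated `R`-module `M`. -/
noncomputable def cls (M : Type u) [AddCommGroup M] [Module R M] [Module.Finite R M] : J R :=
  Submodule.Quotient.mk (basisElt R M)

end Classes

section Rings

variable (R : Type u) [CommRing R]

/-- `R` has finite injective dimension as a module over itself. For a Noetherian local ring this
is the definition of a Gorenstein ring. -/
def FiniteSelfInjectiveDimension : Prop :=
  ∃ n : ℕ, CategoryTheory.HasInjectiveDimensionLE (ModuleCat.of R R) n

/-- A (nonzero) module that is not the internal direct sum of two nonzero submodules. -/
def Indecomposable (M : Type u) [AddCommGroup M] [Module R M] : Prop :=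
  Nontrivial M ∧ ∀ A B : Submodule R M, IsCompl A B → A = ⊥ ∨ B = ⊥

/-- The Krull-Remak-Schmidt property: a decomposition of a finitely generated module as a finite
direct sum of indecomposable modules is unique up to isomorphism and renumbering (the bijection
`σ` forces `m = n`). Finite direct sums are written as finite products. -/
def HasKrullRemakSchmidt : Prop :=
  ∀ (m n : ℕ) (M : Fin m → Type u) (N : Fin n → Type u)
    [∀ i, AddCommGroup (M i)] [∀ i, Module R (M i)] [∀ i, Module.Finite R (M i)]
    [∀ j, AddCommGroup (N j)] [∀ j, Module R (N j)] [∀ j, Module.Finite R (N j)],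
    (∀ i, Indecomposable R (M i)) → (∀ j, Indecomposable R (N j)) →
    Nonempty ((∀ i, M i) ≃ₗ[R] (∀ j, N j)) →
    ∃ σ : Fin m ≃ Fin n, ∀ i, Nonempty (M i ≃ₗ[R] N (σ i))

end Rings

end GrothendieckModule

/-! Krull-Remak-Schmidt lets a module be recorded, up to projective summands, by the multiplicities
`mult` of its nonprojective indecomposable summands. By Schanuel's lemma, taking syzygies induces an
endomorphism `omega` of the free abelian group of multiplicities, and in `J(R)` a class is `t` times
the class of its syzygy, so `t` inverts `omega`.

Finite self-injective dimension makes high syzygies satisfy `Ext^i(-, R) = 0` for `i ≥ 1`. On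
indecomposable nonprojective modules of this kind, `omega` is an injective self-map `θ` of basis
elements (`exists_stable_map`): embeddings into projectives along which forms extend obey a dual
Schanuel lemma, so syzygies can be undone. Hence every `u` in `J(R)` is `t ^ k` times an integral
combination `x` of such classes (`exists_eq_smul_toJ`).

If `r • u = 0`, the maps `syzMult R n`, which kill any given relation for large `n`, turn this into
the vanishing of a nontrivial combination of the shifts of `x` along `θ`. Injectivity then forces
the support of `x` to be periodic (`mem_periodicPts_of_sum_eq_zero`). With `n` a common period, `t ^
n - 1` kills every class in the support. This gives the first claim; for the second, one of these
classes is nonzero when `u` is. -/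

namespace GrothendieckModule

/-! ### Short exact sequences, Schanuel's lemma and its dual -/

section LinearAlgebra

variable {R : Type u} [CommRing R]

/-- The sequence `0 → K → P → N → 0` given by `f` and `g` is exact. -/
structure IsShortExact {K P N : Type u} [AddCommGroup K] [Module R K] [AddCommGroup P] [Module R P]
    [AddCommGroup N] [Module R N] (f : K →ₗ[R] P) (g : P →ₗ[R] N) : Prop where
  injective : Function.Injective f
  exact : Function.Exact f g
  surjective : Function.Surjective g

/-- Every linear form on `K` extends along `f : K → P`. -/
def FormsExtend {K P : Type u} [AddCommGroup K] [Module R K] [AddCommGroup P] [Module R P]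
    (f : K →ₗ[R] P) : Prop :=
  ∀ φ : K →ₗ[R] R, ∃ ψ : P →ₗ[R] R, ψ ∘ₗ f = φ

variable {K P N K' P' N' : Type u} [AddCommGroup K] [Module R K] [AddCommGroup P] [Module R P]
  [AddCommGroup N] [Module R N] [AddCommGroup K'] [Module R K'] [AddCommGroup P'] [Module R P']
  [AddCommGroup N'] [Module R N']

/-- `Q` is a retract of some `R ^ n`: extend coordinate by coordinate, then project back to `Q`. -/
theorem FormsExtend.exists_extension {f : K →ₗ[R] P} (hf : FormsExtend f) {Q : Type u}
    [AddCommGroup Q] [Module R Q] [Module.Finite R Q] [Module.Projective R Q] (φ : K →ₗ[R] Q) :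
    ∃ ψ : P →ₗ[R] Q, ψ ∘ₗ f = φ := by
  obtain ⟨n, p, hp⟩ := Module.Finite.exists_fin' R Q
  obtain ⟨s, hs⟩ := Module.projective_lifting_property p LinearMap.id hp
  choose ψ hψ using fun i => hf (LinearMap.proj i ∘ₗ s ∘ₗ φ)
  refine ⟨p ∘ₗ LinearMap.pi ψ, LinearMap.ext fun x => ?_⟩
  have h : LinearMap.pi ψ (f x) = s (φ x) := by
    funext i
    exact LinearMap.congr_fun (hψ i) x
  simpa [h] using LinearMap.congr_fun hs (φ x)

theorem FormsExtend.prodMap {f : K →ₗ[R] P} {f' : K' →ₗ[R] P'} (hf : FormsExtend f)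
    (hf' : FormsExtend f') : FormsExtend (f.prodMap f') := by
  intro φ
  obtain ⟨ψ, hψ⟩ := hf (φ ∘ₗ LinearMap.inl R K K')
  obtain ⟨ψ', hψ'⟩ := hf' (φ ∘ₗ LinearMap.inr R K K')
  refine ⟨ψ.coprod ψ', LinearMap.ext fun x => ?_⟩
  have h1 := LinearMap.congr_fun hψ x.1
  have h2 := LinearMap.congr_fun hψ' x.2
  simp only [LinearMap.comp_apply, LinearMap.inl_apply, LinearMap.inr_apply] at h1 h2
  simp [h1, h2, ← map_add]

theorem FormsExtend.comp_equiv {f : K →ₗ[R] P} (hf : FormsExtend f) (e : K' ≃ₗ[R] K) :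
    FormsExtend (f ∘ₗ e.toLinearMap) := by
  intro φ
  obtain ⟨ψ, hψ⟩ := hf (φ ∘ₗ e.symm.toLinearMap)
  refine ⟨ψ, LinearMap.ext fun x => ?_⟩
  simpa using LinearMap.congr_fun hψ (e x)

theorem formsExtend_id : FormsExtend (LinearMap.id : K →ₗ[R] K) := fun φ => ⟨φ, rfl⟩

/-- If forms extend along an embedding of a direct sum, they extend along its restriction to a
summand. -/
theorem FormsExtend.comp_inl {f : (K × K') →ₗ[R] P} (hf : FormsExtend f) :
    FormsExtend (f ∘ₗ LinearMap.inl R K K') := by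
  intro φ
  obtain ⟨ψ, hψ⟩ := hf (φ ∘ₗ LinearMap.fst R K K')
  refine ⟨ψ, LinearMap.ext fun x => ?_⟩
  simpa using LinearMap.congr_fun hψ (x, 0)

theorem FormsExtend.comp_inr {f : (K × K') →ₗ[R] P} (hf : FormsExtend f) :
    FormsExtend (f ∘ₗ LinearMap.inr R K K') := by
  intro φ
  obtain ⟨ψ, hψ⟩ := hf (φ ∘ₗ LinearMap.snd R K K')
  refine ⟨ψ, LinearMap.ext fun x => ?_⟩
  simpa using LinearMap.congr_fun hψ (0, x)

theorem IsShortExact.prodMap {f : K →ₗ[R] P} {g : P →ₗ[R] N} {f' : K' →ₗ[R] P'} {g' : P' →ₗ[R] N'}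
    (h : IsShortExact f g) (h' : IsShortExact f' g') :
    IsShortExact (f.prodMap f') (g.prodMap g') where
  injective := by
    rw [LinearMap.coe_prodMap]
    exact h.injective.prodMap h'.injective
  exact := by
    rintro ⟨x, y⟩
    simp [h.exact x, h'.exact y]
  surjective := by
    rw [LinearMap.coe_prodMap]
    exact h.surjective.prodMap h'.surjective

theorem IsShortExact.comp_equiv {f : K →ₗ[R] P} {g : P →ₗ[R] N} (h : IsShortExact f g)
    (e : K' ≃ₗ[R] K) : IsShortExact (f ∘ₗ e.toLinearMap) g where
  injective := by simpa using h.injective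
  exact := by
    intro x
    rw [h.exact x]
    simp [Set.mem_range, e.surjective.exists]
  surjective := h.surjective

theorem IsShortExact.equiv_comp {f : K →ₗ[R] P} {g : P →ₗ[R] N} (h : IsShortExact f g)
    (e : N ≃ₗ[R] N') : IsShortExact f (e.toLinearMap ∘ₗ g) where
  injective := h.injective
  exact := by
    intro x
    simpa using h.exact x
  surjective := by simpa using h.surjective

theorem isShortExact_subtype_ker {g : P →ₗ[R] N} (hg : Function.Surjective g) :
    IsShortExact (LinearMap.ker g).subtype g where
  injective := Subtype.val_injective
  exact := by
    intro x
    simp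
  surjective := hg

theorem isShortExact_mkQ {f : K →ₗ[R] P} (hf : Function.Injective f) :
    IsShortExact f (LinearMap.range f).mkQ where
  injective := hf
  exact := by
    intro x
    simp
  surjective := Submodule.mkQ_surjective _

/-- If the identity extends along `f`, a short exact sequence starting with `f` splits. -/
theorem IsShortExact.nonempty_equiv_of_retraction {f : K →ₗ[R] P} {g : P →ₗ[R] N}
    (h : IsShortExact f g) {r : P →ₗ[R] K} (hr : r ∘ₗ f = LinearMap.id) :
    Nonempty (P ≃ₗ[R] K × N) := by
  have hr' : ∀ x, r (f x) = x := LinearMap.congr_fun hr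
  refine ⟨LinearEquiv.ofBijective (r.prod g) ⟨?_, ?_⟩⟩
  · rw [← LinearMap.ker_eq_bot, LinearMap.ker_eq_bot']
    intro x hx
    simp only [LinearMap.prod_apply, Function.prod_apply, Prod.mk_eq_zero] at hx
    obtain ⟨y, rfl⟩ := (h.exact x).1 hx.2
    rw [← hr' y, hx.1, map_zero]
  · rintro ⟨y, z⟩
    obtain ⟨x, rfl⟩ := h.surjective z
    refine ⟨x + f (y - r x), ?_⟩
    have := (h.exact (f (y - r x))).2 ⟨_, rfl⟩
    simp only [LinearMap.prod_apply, Function.prod_apply, map_add, hr', this]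
    simp

/-- A short exact sequence with projective third term splits. -/
theorem IsShortExact.nonempty_equiv_of_projective {f : K →ₗ[R] P} {g : P →ₗ[R] N}
    (h : IsShortExact f g) [Module.Projective R N] : Nonempty (P ≃ₗ[R] K × N) := by
  obtain ⟨s, hs⟩ := Module.projective_lifting_property g LinearMap.id h.surjective
  have hs' : ∀ x, g (s x) = x := LinearMap.congr_fun hs
  refine ⟨(LinearEquiv.ofBijective (f.coprod s) ⟨?_, ?_⟩).symm⟩
  · rw [← LinearMap.ker_eq_bot, LinearMap.ker_eq_bot']
    rintro ⟨x, y⟩ hx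
    simp only [LinearMap.coprod_apply] at hx
    have h1 := congrArg g hx
    rw [map_add, hs', (h.exact (f x)).2 ⟨_, rfl⟩, zero_add, map_zero] at h1
    subst h1
    rw [map_zero, add_zero] at hx
    simp [h.injective (hx.trans (map_zero f).symm)]
  · intro y
    obtain ⟨x, hx⟩ := (h.exact (y - s (g y))).1 (by simp [hs'])
    exact ⟨(x, g y), by simp [hx]⟩

theorem projective_left_of_equiv_prod [Module.Projective R P] (e : P ≃ₗ[R] K × N) :
    Module.Projective R K :=
  .of_split (e.symm.toLinearMap ∘ₗ LinearMap.inl R K N) (LinearMap.fst R K N ∘ₗ e.toLinearMap)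
    (by ext; simp)

theorem projective_right_of_equiv_prod [Module.Projective R P] (e : P ≃ₗ[R] K × N) :
    Module.Projective R N :=
  .of_split (e.symm.toLinearMap ∘ₗ LinearMap.inr R K N) (LinearMap.snd R K N ∘ₗ e.toLinearMap)
    (by ext; simp)

/-- If `P'` is projective, `K × P'` is isomorphic to the fibre product of `P` and `P'` over `N`. -/
theorem exists_injective_range_eq_fiberProduct [Module.Projective R P'] {f : K →ₗ[R] P}
    {g : P →ₗ[R] N} (h : IsShortExact f g) (g' : P' →ₗ[R] N) :
    ∃ j : (K × P') →ₗ[R] P × P', Function.Injective j ∧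
      LinearMap.range j = LinearMap.ker (g ∘ₗ LinearMap.fst R P P' - g' ∘ₗ LinearMap.snd R P P') := by
  obtain ⟨s, hs⟩ := Module.projective_lifting_property g g' h.surjective
  have hs' : ∀ x, g (s x) = g' x := LinearMap.congr_fun hs
  refine ⟨(f.coprod s).prod (LinearMap.snd R K P'), ?_, ?_⟩
  · rw [← LinearMap.ker_eq_bot, LinearMap.ker_eq_bot']
    rintro ⟨x, y⟩ hx
    simp only [LinearMap.prod_apply, Function.prod_apply, LinearMap.coprod_apply, LinearMap.snd_apply,
      Prod.mk_eq_zero] at hx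
    obtain ⟨hx, rfl⟩ := hx
    rw [map_zero, add_zero] at hx
    simp [h.injective (hx.trans (map_zero f).symm)]
  · ext ⟨p, p'⟩
    simp only [LinearMap.mem_range, LinearMap.mem_ker, LinearMap.sub_apply, LinearMap.comp_apply,
      LinearMap.fst_apply, LinearMap.snd_apply, sub_eq_zero, Prod.exists, LinearMap.prod_apply,
      Function.prod_apply, LinearMap.coprod_apply, Prod.mk.injEq]
    constructor
    · rintro ⟨x, y, rfl, rfl⟩
      rw [map_add, hs', (h.exact (f x)).2 ⟨_, rfl⟩, zero_add]
    · intro hp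
      obtain ⟨x, hx⟩ := (h.exact (p - s p')).1 (by rw [map_sub, hs', hp, sub_self])
      exact ⟨x, p', by rw [hx, sub_add_cancel], rfl⟩

/-- Schanuel's lemma. -/
theorem IsShortExact.schanuel [Module.Projective R P] [Module.Projective R P'] {f : K →ₗ[R] P}
    {g : P →ₗ[R] N} {f' : K' →ₗ[R] P'} {g' : P' →ₗ[R] N} (h : IsShortExact f g)
    (h' : IsShortExact f' g') : Nonempty ((K × P') ≃ₗ[R] K' × P) := by
  obtain ⟨j, hj, hr⟩ := exists_injective_range_eq_fiberProduct h g'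
  obtain ⟨j', hj', hr'⟩ := exists_injective_range_eq_fiberProduct h' g
  have hmap : (LinearMap.range j).map (LinearEquiv.prodComm R P P').toLinearMap =
      LinearMap.range j' := ?_
  · exact ⟨(LinearEquiv.ofInjective j hj).trans
      ((LinearEquiv.ofSubmodules (LinearEquiv.prodComm R P P') _ _ hmap).trans
        (LinearEquiv.ofInjective j' hj').symm)⟩
  rw [hr, hr']
  ext ⟨p', p⟩
  rw [Submodule.mem_map_equiv, LinearMap.mem_ker, LinearMap.mem_ker]
  change g p - g' p' = 0 ↔ g' p' - g p = 0
  rw [sub_eq_zero, sub_eq_zero, eq_comm]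

/-- The shear `(p, p') ↦ (p, p' - e p)` carries the diagonal copy of `K` to `f(K) × 0`, whose
quotient is `N × P'`. In the dual Schanuel lemma the same diagonal is divided out in two ways. -/
theorem exists_surjective_ker_eq_diagonal {f : K →ₗ[R] P} {g : P →ₗ[R] N} (h : IsShortExact f g)
    {f' : K →ₗ[R] P'} {e : P →ₗ[R] P'} (he : e ∘ₗ f = f') :
    ∃ q : (P × P') →ₗ[R] N × P', Function.Surjective q ∧
      LinearMap.ker q = LinearMap.range (f.prod f') := by
  have he' : ∀ x, e (f x) = f' x := LinearMap.congr_fun he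
  refine ⟨(g ∘ₗ LinearMap.fst R P P').prod (LinearMap.snd R P P' - e ∘ₗ LinearMap.fst R P P'),
    ?_, ?_⟩
  · rintro ⟨y, z⟩
    obtain ⟨x, rfl⟩ := h.surjective y
    exact ⟨(x, z + e x), by simp⟩
  · ext ⟨p, p'⟩
    simp only [LinearMap.mem_ker, LinearMap.prod_apply, Function.prod_apply, LinearMap.comp_apply,
      LinearMap.sub_apply, LinearMap.fst_apply, LinearMap.snd_apply, Prod.mk_eq_zero, sub_eq_zero,
      LinearMap.mem_range, Prod.mk.injEq]
    constructor
    · rintro ⟨h1, rfl⟩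
      obtain ⟨x, rfl⟩ := (h.exact p).1 h1
      exact ⟨x, rfl, (he' x).symm⟩
    · rintro ⟨x, rfl, rfl⟩
      exact ⟨(h.exact (f x)).2 ⟨_, rfl⟩, (he' x).symm⟩

/-- The dual of Schanuel's lemma, for embeddings into finitely generated projective modules along
which linear forms extend. -/
theorem IsShortExact.dual_schanuel [Module.Finite R P] [Module.Projective R P] [Module.Finite R P']
    [Module.Projective R P'] {f : K →ₗ[R] P}
    {g : P →ₗ[R] N} {f' : K →ₗ[R] P'} {g' : P' →ₗ[R] N'} (h : IsShortExact f g)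
    (h' : IsShortExact f' g') (hf : FormsExtend f) (hf' : FormsExtend f') :
    Nonempty ((N × P') ≃ₗ[R] N' × P) := by
  obtain ⟨e, he⟩ := hf.exists_extension f'
  obtain ⟨e', he'⟩ := hf'.exists_extension f
  obtain ⟨q, hq, hk⟩ := exists_surjective_ker_eq_diagonal h he
  obtain ⟨q', hq', hk'⟩ := exists_surjective_ker_eq_diagonal h' he'
  have hmap : (LinearMap.ker q).map (LinearEquiv.prodComm R P P').toLinearMap =
      LinearMap.ker q' := ?_
  · exact ⟨(q.quotKerEquivOfSurjective hq).symm.trans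
      ((Submodule.Quotient.equiv _ _ (LinearEquiv.prodComm R P P') hmap).trans
        (q'.quotKerEquivOfSurjective hq'))⟩
  rw [hk, hk']
  ext ⟨p', p⟩
  rw [← LinearMap.range_comp]
  simp [and_comm]

end LinearAlgebra

/-! ### Multiplicities of nonprojective indecomposable summands -/

section Multiplicity

variable {R : Type u} [CommRing R]

/-- The isomorphism class of a finitely generated module. -/
def isoClass (R : Type u) [CommRing R] (M : Type u) [AddCommGroup M] [Module R M]
    [Module.Finite R M] : FGClass R :=
  Quotient.mk _ (FGModuleCat.of R M)

theorem isoClass_eq_iff {M N : Type u} [AddCommGroup M] [Module R M] [Module.Finite R M]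
    [AddCommGroup N] [Module R N] [Module.Finite R N] :
    isoClass R M = isoClass R N ↔ Nonempty (M ≃ₗ[R] N) := by
  rw [isoClass, isoClass, Quotient.eq]
  exact ⟨fun ⟨e⟩ => ⟨FGModuleCat.isoToLinearEquiv e⟩, fun ⟨e⟩ => ⟨e.toFGModuleCatIso⟩⟩

theorem isoClass_out (c : FGClass R) : isoClass R c.out = c :=
  Quotient.out_eq c

theorem Indecomposable.of_equiv {M N : Type u} [AddCommGroup M] [Module R M]
    [AddCommGroup N] [Module R N] (hM : Indecomposable R M) (e : M ≃ₗ[R] N) :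
    Indecomposable R N := by
  have := hM.1
  refine ⟨e.symm.toEquiv.nontrivial, fun A B hAB => ?_⟩
  have h := hM.2 (A.map e.symm.toLinearMap) (B.map e.symm.toLinearMap)
    ((Submodule.orderIsoMapComap e.symm).isCompl hAB)
  simpa [Submodule.map_eq_bot_iff] using h

/-- A property of finitely generated modules over a Noetherian ring that is invariant under
isomorphism and direct sums and holds for the zero module and for indecomposable modules holds for
all finitely generated modules. -/
theorem finite_module_induction [IsNoetherianRing R]
    {motive : ∀ (M : Type u) [AddCommGroup M] [Module R M] [Module.Finite R M], Prop}
    (equiv : ∀ (M N : Type u) [AddCommGroup M] [Module R M] [Module.Finite R M]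
      [AddCommGroup N] [Module R N] [Module.Finite R N], (M ≃ₗ[R] N) → motive M → motive N)
    (subsingleton : ∀ (M : Type u) [AddCommGroup M] [Module R M] [Module.Finite R M],
      Subsingleton M → motive M)
    (indecomposable : ∀ (M : Type u) [AddCommGroup M] [Module R M] [Module.Finite R M],
      Indecomposable R M → motive M)
    (prod : ∀ (M N : Type u) [AddCommGroup M] [Module R M] [Module.Finite R M]
      [AddCommGroup N] [Module R N] [Module.Finite R N], motive M → motive N → motive (M × N))
    (M : Type u) [AddCommGroup M] [Module R M] [Module.Finite R M] : motive M := by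
  suffices h : ∀ N : Submodule R M, motive (M ⧸ N) from
    equiv _ _ (Submodule.quotEquivOfEqBot ⊥ rfl) (h ⊥)
  have : IsNoetherian R M := isNoetherian_of_isNoetherianRing_of_finite R M
  intro N
  induction N using WellFoundedGT.induction with
  | ind N ih =>
    by_cases hs : Subsingleton (M ⧸ N)
    · exact subsingleton _ hs
    by_cases hi : Indecomposable R (M ⧸ N)
    · exact indecomposable _ hi
    rw [not_subsingleton_iff_nontrivial] at hs
    simp only [Indecomposable, hs, true_and, not_forall, not_or] at hi
    obtain ⟨A, B, hAB, hA, hB⟩ := hi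
    -- Noetherian induction: dividing `M ⧸ N` by a nonzero submodule amounts to dividing `M` by a
    -- strictly larger one. Both complementary summands are such quotients.
    have key : ∀ A : Submodule R (M ⧸ N), A ≠ ⊥ → motive ((M ⧸ N) ⧸ A) := by
      intro A hA
      have hker : LinearMap.ker (A.mkQ ∘ₗ N.mkQ) = A.comap N.mkQ := by
        rw [LinearMap.ker_comp, Submodule.ker_mkQ]
      refine equiv _ _ ((A.mkQ ∘ₗ N.mkQ).quotKerEquivOfSurjective
        (A.mkQ_surjective.comp N.mkQ_surjective)) (ih _ ?_)
      rw [hker]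
      refine lt_of_le_of_ne (N.le_comap_mkQ A) fun h => hA ?_
      rw [← Submodule.map_comap_eq_of_surjective N.mkQ_surjective A, ← h, N.mkQ_map_self]
    exact equiv _ _ (((Submodule.quotientEquivOfIsCompl A B hAB).prodCongr
      (Submodule.quotientEquivOfIsCompl B A hAB.symm)).trans
      ((LinearEquiv.prodComm R B A).trans (Submodule.prodEquivOfIsCompl A B hAB)))
      (prod _ _ (key A hA) (key B hB))

/-- `M` is isomorphic to the direct sum of the family `X` of indecomposable modules. -/
structure IsDecomposition (M : Type u) [AddCommGroup M] [Module R M] {ι : Type}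
    (X : ι → FGModuleCat.{u} R) : Prop where
  indecomposable : ∀ i, Indecomposable R (X i)
  nonempty_equiv : Nonempty (M ≃ₗ[R] ∀ i, X i)

open Classical in
/-- The formal sum of the classes of the nonprojective members of a family of modules. -/
noncomputable def nonprojectiveSum {ι : Type} [Fintype ι] (X : ι → FGModuleCat.{u} R) :
    FGClass R →₀ ℤ :=
  ∑ i, if Module.Projective R (X i) then 0 else Finsupp.single (isoClass R (X i)) 1

theorem IsDecomposition.comp_equiv {M : Type u} [AddCommGroup M] [Module R M] {ι κ : Type}
    {X : ι → FGModuleCat.{u} R} (h : IsDecomposition M X) (e : κ ≃ ι) :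
    IsDecomposition M (X ∘ e) where
  indecomposable i := h.indecomposable (e i)
  nonempty_equiv := h.nonempty_equiv.map fun f =>
    f.trans (LinearEquiv.piCongrLeft R (fun i => (X i : Type u)) e).symm

theorem nonprojectiveSum_comp_equiv {ι κ : Type} [Fintype ι] [Fintype κ]
    (X : ι → FGModuleCat.{u} R) (e : κ ≃ ι) : nonprojectiveSum (X ∘ e) = nonprojectiveSum X :=
  e.sum_comp fun i => open Classical in
    if Module.Projective R (X i) then 0 else Finsupp.single (isoClass R (X i)) 1

theorem projective_iff_of_equiv {M N : Type u} [AddCommGroup M] [Module R M]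
    [AddCommGroup N] [Module R N] (e : M ≃ₗ[R] N) :
    Module.Projective R M ↔ Module.Projective R N :=
  ⟨fun _ => .of_equiv e, fun _ => .of_equiv e.symm⟩

theorem IsDecomposition.nonprojectiveSum_eq (hKRS : HasKrullRemakSchmidt R) {M N : Type u}
    [AddCommGroup M] [Module R M] [AddCommGroup N] [Module R N] (e : M ≃ₗ[R] N)
    {ι κ : Type} [Fintype ι] [Fintype κ] {X : ι → FGModuleCat.{u} R} {Y : κ → FGModuleCat.{u} R}
    (hX : IsDecomposition M X) (hY : IsDecomposition N Y) :
    nonprojectiveSum X = nonprojectiveSum Y := by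
  -- Krull-Remak-Schmidt is stated for families over `Fin`, so both decompositions are reindexed.
  rw [← nonprojectiveSum_comp_equiv X (Fintype.equivFin ι).symm,
    ← nonprojectiveSum_comp_equiv Y (Fintype.equivFin κ).symm]
  replace hX := hX.comp_equiv (Fintype.equivFin ι).symm
  replace hY := hY.comp_equiv (Fintype.equivFin κ).symm
  obtain ⟨f⟩ := hX.nonempty_equiv
  obtain ⟨g⟩ := hY.nonempty_equiv
  obtain ⟨σ, hσ⟩ := hKRS _ _ (fun i => (X ((Fintype.equivFin ι).symm i) : Type u))
    (fun i => (Y ((Fintype.equivFin κ).symm i) : Type u)) hX.indecomposable hY.indecomposable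
    ⟨f.symm.trans (e.trans g)⟩
  rw [← nonprojectiveSum_comp_equiv _ σ]
  refine Finset.sum_congr rfl fun i _ => ?_
  obtain ⟨h⟩ := hσ i
  have h1 := projective_iff_of_equiv h
  have h2 := isoClass_eq_iff.2 ⟨h⟩
  simp only [Function.comp_apply]
  rw [h2]
  classical exact if_congr h1 rfl rfl

theorem IsDecomposition.sum {M N : Type u}
    [AddCommGroup M] [Module R M] [AddCommGroup N] [Module R N]
    {ι κ : Type} {X : ι → FGModuleCat.{u} R} {Y : κ → FGModuleCat.{u} R}
    (hX : IsDecomposition M X) (hY : IsDecomposition N Y) :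
    IsDecomposition (M × N) (Sum.elim X Y) where
  indecomposable i := by
    cases i with
    | inl i => exact hX.indecomposable i
    | inr i => exact hY.indecomposable i
  nonempty_equiv := by
    obtain ⟨f⟩ := hX.nonempty_equiv
    obtain ⟨g⟩ := hY.nonempty_equiv
    exact ⟨(f.prodCongr g).trans
      (LinearEquiv.sumPiEquivProdPi R ι κ fun i => ((Sum.elim X Y i).carrier : Type u)).symm⟩

theorem isDecomposition_of_subsingleton (M : Type u) [AddCommGroup M] [Module R M]
    [Subsingleton M] : IsDecomposition M (fun i : Empty => (i.elim : FGModuleCat.{u} R)) where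
  indecomposable i := i.elim
  nonempty_equiv := ⟨LinearEquiv.ofSubsingleton _ _⟩

theorem Indecomposable.isDecomposition {M : Type u} [AddCommGroup M] [Module R M]
    [Module.Finite R M] (hM : Indecomposable R M) :
    IsDecomposition M (fun _ : Unit => FGModuleCat.of R M) where
  indecomposable _ := hM
  nonempty_equiv := ⟨(LinearEquiv.funUnique Unit R M).symm⟩

theorem exists_isDecomposition [IsNoetherianRing R] (M : Type u) [AddCommGroup M] [Module R M]
    [Module.Finite R M] :
    ∃ (ι : Type) (_ : Fintype ι) (X : ι → FGModuleCat.{u} R), IsDecomposition M X := by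
  refine finite_module_induction (R := R) (motive := fun M _ _ _ =>
    ∃ (ι : Type) (_ : Fintype ι) (X : ι → FGModuleCat.{u} R), IsDecomposition M X)
    ?equiv ?subsingleton ?indecomposable ?prod M
  case equiv =>
    intro M N _ _ _ _ _ _ e h
    obtain ⟨ι, _, X, h⟩ := h
    exact ⟨ι, ‹_›, X, h.indecomposable, h.nonempty_equiv.map e.symm.trans⟩
  case subsingleton => exact fun M _ _ _ _ => ⟨Empty, inferInstance, _, isDecomposition_of_subsingleton M⟩
  case indecomposable => exact fun M _ _ _ h => ⟨Unit, inferInstance, _, h.isDecomposition⟩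
  case prod =>
    intro M N _ _ _ _ _ _ hM hN
    obtain ⟨ι, _, X, hX⟩ := hM
    obtain ⟨κ, _, Y, hY⟩ := hN
    exact ⟨ι ⊕ κ, inferInstance, _, hX.sum hY⟩

variable [IsNoetherianRing R]

/-- The multiplicities of the nonprojective indecomposable modules as direct summands of `M`. -/
noncomputable def mult (R : Type u) [CommRing R] [IsNoetherianRing R] (M : Type u)
    [AddCommGroup M] [Module R M] [Module.Finite R M] : FGClass R →₀ ℤ :=
  letI := (exists_isDecomposition (R := R) M).choose_spec.choose
  nonprojectiveSum (exists_isDecomposition (R := R) M).choose_spec.choose_spec.choose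

variable {M N : Type u} [AddCommGroup M] [Module R M] [Module.Finite R M]
    [AddCommGroup N] [Module R N] [Module.Finite R N]

theorem mult_eq (hKRS : HasKrullRemakSchmidt R) {ι : Type} [Fintype ι]
    {X : ι → FGModuleCat.{u} R} (hX : IsDecomposition M X) : mult R M = nonprojectiveSum X :=
  letI := (exists_isDecomposition (R := R) M).choose_spec.choose
  (exists_isDecomposition (R := R) M).choose_spec.choose_spec.choose_spec.nonprojectiveSum_eq
    hKRS (LinearEquiv.refl R M) hX

theorem mult_congr (hKRS : HasKrullRemakSchmidt R) (e : M ≃ₗ[R] N) : mult R M = mult R N := by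
  obtain ⟨ι, _, X, hX⟩ := exists_isDecomposition (R := R) M
  rw [mult_eq hKRS hX]
  exact (mult_eq hKRS ⟨hX.indecomposable, hX.nonempty_equiv.map e.symm.trans⟩).symm

theorem mult_prod (hKRS : HasKrullRemakSchmidt R) : mult R (M × N) = mult R M + mult R N := by
  obtain ⟨ι, _, X, hX⟩ := exists_isDecomposition (R := R) M
  obtain ⟨κ, _, Y, hY⟩ := exists_isDecomposition (R := R) N
  rw [mult_eq hKRS hX, mult_eq hKRS hY, mult_eq hKRS (hX.sum hY)]
  exact Fintype.sum_sum_type _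

theorem mult_of_subsingleton (hKRS : HasKrullRemakSchmidt R) [Subsingleton M] :
    mult R M = 0 := by
  rw [mult_eq hKRS (isDecomposition_of_subsingleton M)]
  simp [nonprojectiveSum]

theorem mult_of_indecomposable (hKRS : HasKrullRemakSchmidt R) (hM : Indecomposable R M)
    (h : ¬ Module.Projective R M) : mult R M = Finsupp.single (isoClass R M) 1 := by
  rw [mult_eq hKRS hM.isDecomposition]
  simp [nonprojectiveSum, h]

theorem mult_of_projective (hKRS : HasKrullRemakSchmidt R) (h : Module.Projective R M) :
    mult R M = 0 := by
  revert h
  refine finite_module_induction (R := R) (motive := fun M _ _ _ => Module.Projective R M → mult R M = 0)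
    ?equiv ?subsingleton ?indecomposable ?prod M
  case equiv =>
    intro M N _ _ _ _ _ _ e ih h
    rw [← mult_congr hKRS e]
    exact ih (.of_equiv e.symm)
  case subsingleton =>
    intro M _ _ _ hM h
    exact mult_of_subsingleton hKRS
  case indecomposable =>
    intro M _ _ _ hM h
    rw [mult_eq hKRS hM.isDecomposition]
    simp [nonprojectiveSum, h]
  case prod =>
    intro M N _ _ _ _ _ _ hM hN h
    rw [mult_prod hKRS, hM (projective_left_of_equiv_prod (LinearEquiv.refl R (M × N))),
      hN (projective_right_of_equiv_prod (LinearEquiv.refl R (M × N))), add_zero]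

theorem mult_nonneg (M : Type u) [AddCommGroup M] [Module R M] [Module.Finite R M] :
    0 ≤ mult R M := by
  classical
  refine Finset.sum_nonneg fun i _ => ?_
  split_ifs
  · exact le_rfl
  · exact Finsupp.single_nonneg.2 zero_le_one

/-- Multiplicities are nonnegative, so those of two summands cannot cancel and the claim reduces to
indecomposables. -/
theorem projective_of_mult_eq_zero (hKRS : HasKrullRemakSchmidt R) (h : mult R M = 0) :
    Module.Projective R M := by
  revert h
  refine finite_module_induction (R := R) (motive := fun M _ _ _ => mult R M = 0 → Module.Projective R M)
    ?equiv ?subsingleton ?indecomposable ?prod M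
  case equiv =>
    intro M N _ _ _ _ _ _ e ih h
    rw [← mult_congr hKRS e] at h
    have := ih h
    exact .of_equiv e
  case subsingleton =>
    intro M _ _ _ hM h
    infer_instance
  case indecomposable =>
    intro M _ _ _ hM h
    by_contra hp
    rw [mult_of_indecomposable hKRS hM hp] at h
    simp at h
  case prod =>
    intro M N _ _ _ _ _ _ hM hN h
    rw [mult_prod hKRS, add_eq_zero_iff_of_nonneg (mult_nonneg M) (mult_nonneg N)] at h
    have := hM h.1
    have := hN h.2
    infer_instance

/-- A class of positive multiplicity in `M` is the class of a direct summand of `M`. -/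
theorem exists_summand_of_mem_support (hKRS : HasKrullRemakSchmidt R) {c : FGClass R}
    (hc : mult R M c ≠ 0) :
    ∃ (C F : Type u) (_ : AddCommGroup C) (_ : Module R C) (_ : Module.Finite R C)
      (_ : AddCommGroup F) (_ : Module R F) (_ : Module.Finite R F),
      isoClass R C = c ∧ Indecomposable R C ∧ ¬ Module.Projective R C ∧
        Nonempty (M ≃ₗ[R] C × F) := by
  revert hc
  refine finite_module_induction (R := R) (motive := fun M _ _ _ => mult R M c ≠ 0 →
    ∃ (C F : Type u) (_ : AddCommGroup C) (_ : Module R C) (_ : Module.Finite R C)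
      (_ : AddCommGroup F) (_ : Module R F) (_ : Module.Finite R F),
      isoClass R C = c ∧ Indecomposable R C ∧ ¬ Module.Projective R C ∧
        Nonempty (M ≃ₗ[R] C × F))
    ?equiv ?subsingleton ?indecomposable ?prod M
  case equiv =>
    intro M N _ _ _ _ _ _ e ih hc
    rw [← mult_congr hKRS e] at hc
    obtain ⟨C, F, _, _, _, _, _, _, h1, h2, h3, ⟨f⟩⟩ := ih hc
    exact ⟨C, F, _, _, ‹_›, _, _, ‹_›, h1, h2, h3, ⟨e.symm.trans f⟩⟩
  case subsingleton =>
    intro M _ _ _ hM hc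
    simp [mult_of_subsingleton hKRS] at hc
  case indecomposable =>
    intro M _ _ _ hM hc
    by_cases hp : Module.Projective R M
    · simp [mult_of_projective hKRS hp] at hc
    rw [mult_of_indecomposable hKRS hM hp] at hc
    have hcM : isoClass R M = c := by
      by_contra hne
      exact hc (Finsupp.single_eq_of_ne' hne)
    exact ⟨M, PUnit, _, _, ‹_›, _, _, inferInstance, hcM, hM, hp,
      ⟨LinearEquiv.prodUnique.symm⟩⟩
  case prod =>
    intro M N _ _ _ _ _ _ hM hN hc
    rw [mult_prod hKRS, Finsupp.add_apply] at hc
    by_cases hcM : mult R M c = 0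
    · rw [hcM, zero_add] at hc
      obtain ⟨C, F, _, _, _, _, _, _, h1, h2, h3, ⟨f⟩⟩ := hN hc
      exact ⟨C, F × M, _, _, ‹_›, _, _, inferInstance, h1, h2, h3,
        ⟨(LinearEquiv.prodComm R M N).trans
          ((f.prodCongr (LinearEquiv.refl R M)).trans (LinearEquiv.prodAssoc R C F M))⟩⟩
    · obtain ⟨C, F, _, _, _, _, _, _, h1, h2, h3, ⟨f⟩⟩ := hM hcM
      exact ⟨C, F × N, _, _, ‹_›, _, _, inferInstance, h1, h2, h3,
        ⟨(f.prodCongr (LinearEquiv.refl R N)).trans (LinearEquiv.prodAssoc R C F N)⟩⟩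

end Multiplicity

/-! ### Vanishing of Ext into the ring -/

section ExtVanishing

open CategoryTheory Abelian

variable {R : Type u} [CommRing R]

/-- `Ext^i(M, R) = 0` for all `i ≥ k`. -/
def ExtVanishesFrom (R : Type u) [CommRing R] (M : Type u) [AddCommGroup M] [Module R M]
    (k : ℕ) : Prop :=
  ∀ i, k ≤ i → ∀ e : Ext.{u} (ModuleCat.of R M) (ModuleCat.of R R) i, e = 0

theorem FiniteSelfInjectiveDimension.exists_extVanishesFrom
    (h : FiniteSelfInjectiveDimension R) :
    ∃ n : ℕ, ∀ (M : Type u) [AddCommGroup M] [Module R M], ExtVanishesFrom R M (n + 1) := by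
  obtain ⟨n, hn⟩ := h
  exact ⟨n, fun M _ _ i hi e => e.eq_zero_of_hasInjectiveDimensionLT (n + 1) hi⟩

variable {K P N : Type u} [AddCommGroup K] [Module R K] [AddCommGroup P] [Module R P]
  [AddCommGroup N] [Module R N]

theorem IsShortExact.shortExact {f : K →ₗ[R] P} {g : P →ₗ[R] N} (h : IsShortExact f g) :
    (ShortComplex.mk (ModuleCat.ofHom f) (ModuleCat.ofHom g)
      (by rw [← ModuleCat.ofHom_comp, h.exact.linearMap_comp_eq_zero]; rfl)).ShortExact where
  exact := (ShortComplex.ShortExact.moduleCat_exact_iff_function_exact _).2 h.exact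
  mono_f := (ModuleCat.mono_iff_injective _).2 h.injective
  epi_g := (ModuleCat.epi_iff_surjective _).2 h.surjective

/-- Dimension shifting: `Ext^i(K, R)` lies between `Ext^i(P, R)` and `Ext^{i+1}(N, R)`. The bound `1
≤ k` is what makes the former vanish. -/
theorem ExtVanishesFrom.syzygy [Module.Projective R P] {f : K →ₗ[R] P} {g : P →ₗ[R] N}
    (h : IsShortExact f g) {k : ℕ} (hk : 1 ≤ k) (hN : ExtVanishesFrom R N (k + 1)) :
    ExtVanishesFrom R K k := by
  intro i hi x
  obtain ⟨i, rfl⟩ := Nat.exists_eq_add_of_le' (hk.trans hi)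
  obtain ⟨y, rfl⟩ := Ext.contravariant_sequence_exact₁ h.shortExact _ x (add_comm 1 (i + 1))
    (hN _ (by lia) _)
  rw [Ext.eq_zero_of_projective y, Ext.comp_zero]

/-- The obstruction to extending a form from `K` to `P` lies in `Ext^1(N, R)`. -/
theorem ExtVanishesFrom.formsExtend {f : K →ₗ[R] P} {g : P →ₗ[R] N}
    (h : IsShortExact f g) (hN : ExtVanishesFrom R N 1) : FormsExtend f := by
  intro φ
  obtain ⟨y, hy⟩ := Ext.contravariant_sequence_exact₁ h.shortExact _
    (Ext.mk₀ (ModuleCat.ofHom φ)) (add_comm 1 0) (hN _ le_rfl _)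
  obtain ⟨ψ, rfl⟩ := Ext.homEquiv₀.symm.surjective y
  refine ⟨ψ.hom, ?_⟩
  change (Ext.mk₀ (ModuleCat.ofHom f)).comp (Ext.mk₀ ψ) _ = _ at hy
  rw [Ext.mk₀_comp_mk₀] at hy
  exact congrArg ModuleCat.Hom.hom ((Ext.mk₀_bijective _ _).1 hy)

theorem ExtVanishesFrom.of_retract {k : ℕ} (hN : ExtVanishesFrom R N k) (s : K →ₗ[R] N)
    (r : N →ₗ[R] K) (hrs : r ∘ₗ s = LinearMap.id) : ExtVanishesFrom R K k := by
  intro i hi x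
  have h : ModuleCat.ofHom s ≫ ModuleCat.ofHom r = 𝟙 _ := by
    rw [← ModuleCat.ofHom_comp, hrs, ModuleCat.ofHom_id]
  rw [← Ext.mk₀_id_comp x, ← h, ← Ext.mk₀_comp_mk₀_assoc,
    hN i hi ((Ext.mk₀ (ModuleCat.ofHom r)).comp x (zero_add i)), Ext.comp_zero]

/-- An indecomposable nonprojective module `M` with `Ext^i(M, R) = 0` for all `i ≥ 1`. -/
structure IsStableIndecomposable (R : Type u) [CommRing R] (M : Type u) [AddCommGroup M]
    [Module R M] : Prop where
  indecomposable : Indecomposable R M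
  not_projective : ¬ Module.Projective R M
  ext_vanishes : ExtVanishesFrom R M 1

theorem IsStableIndecomposable.of_equiv {M N : Type u} [AddCommGroup M] [Module R M]
    [AddCommGroup N] [Module R N] (hM : IsStableIndecomposable R M) (e : M ≃ₗ[R] N) :
    IsStableIndecomposable R N where
  indecomposable := hM.indecomposable.of_equiv e
  not_projective := by
    rw [← projective_iff_of_equiv e]
    exact hM.not_projective
  ext_vanishes := hM.ext_vanishes.of_retract e.symm.toLinearMap e.toLinearMap (by ext; simp)

/-- The classes of indecomposable nonprojective modules `M` with `Ext^i(M, R) = 0` for all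
`i ≥ 1`. -/
def stableClasses (R : Type u) [CommRing R] : Set (FGClass R) :=
  {c | IsStableIndecomposable R c.out}

theorem isoClass_mem_stableClasses {M : Type u} [AddCommGroup M] [Module R M] [Module.Finite R M]
    (hM : IsStableIndecomposable R M) : isoClass R M ∈ stableClasses R := by
  obtain ⟨e⟩ := isoClass_eq_iff.1 (isoClass_out (isoClass R M)).symm
  exact hM.of_equiv e

end ExtVanishing

/-! ### Syzygies and their action on multiplicities -/

section Syzygy

variable {R : Type u} [CommRing R]

/-- The rank of the chosen free module that maps onto `M`. -/
noncomputable def coverRank (R : Type u) [CommRing R] (M : Type u) [AddCommGroup M] [Module R M]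
    [Module.Finite R M] : ℕ :=
  (Module.Finite.exists_fin' R M).choose

/-- The chosen surjection from a finite free module onto `M`. -/
noncomputable def cover (R : Type u) [CommRing R] (M : Type u) [AddCommGroup M] [Module R M]
    [Module.Finite R M] : (Fin (coverRank R M) → R) →ₗ[R] M :=
  (Module.Finite.exists_fin' R M).choose_spec.choose

/-- The chosen syzygy module of `M`. -/
abbrev Syz (R : Type u) [CommRing R] (M : Type u) [AddCommGroup M] [Module R M]
    [Module.Finite R M] : Type u :=
  LinearMap.ker (cover R M)

theorem isShortExact_syz (M : Type u) [AddCommGroup M] [Module R M] [Module.Finite R M] :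
    IsShortExact (LinearMap.ker (cover R M)).subtype (cover R M) :=
  isShortExact_subtype_ker (Module.Finite.exists_fin' R M).choose_spec.choose_spec

variable [IsNoetherianRing R]

/-- The effect of taking syzygies on multiplicities of indecomposable summands. -/
noncomputable def omega (R : Type u) [CommRing R] [IsNoetherianRing R] :
    (FGClass R →₀ ℤ) →ₗ[ℤ] (FGClass R →₀ ℤ) :=
  Finsupp.linearCombination ℤ fun c => mult R (Syz R c.out)

theorem omega_single (c : FGClass R) : omega R (Finsupp.single c 1) = mult R (Syz R c.out) := by
  simp [omega]

variable {K P N K' P' N' : Type u} [AddCommGroup K] [Module R K]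
  [AddCommGroup P] [Module R P] [Module.Finite R P] [Module.Projective R P]
  [AddCommGroup N] [Module R N]
  [AddCommGroup K'] [Module R K']
  [AddCommGroup P'] [Module R P'] [Module.Finite R P'] [Module.Projective R P']
  [AddCommGroup N'] [Module R N']

theorem IsShortExact.mult_eq_mult [Module.Finite R K] [Module.Finite R K']
    (hKRS : HasKrullRemakSchmidt R) {f : K →ₗ[R] P}
    {g : P →ₗ[R] N} {f' : K' →ₗ[R] P'} {g' : P' →ₗ[R] N'} (h : IsShortExact f g)
    (h' : IsShortExact f' g') (e : N ≃ₗ[R] N') : mult R K = mult R K' := by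
  obtain ⟨e'⟩ := (h.equiv_comp e).schanuel h'
  have h1 := mult_congr hKRS e'
  rwa [mult_prod hKRS, mult_prod hKRS, mult_of_projective hKRS ‹Module.Projective R P'›,
    mult_of_projective hKRS ‹Module.Projective R P›, add_zero, add_zero] at h1

theorem IsShortExact.mult_eq_mult_of_formsExtend [Module.Finite R N] [Module.Finite R N']
    (hKRS : HasKrullRemakSchmidt R) {f : K →ₗ[R] P}
    {g : P →ₗ[R] N} {f' : K' →ₗ[R] P'} {g' : P' →ₗ[R] N'} (h : IsShortExact f g)
    (h' : IsShortExact f' g') (hf : FormsExtend f) (hf' : FormsExtend f') (e : K ≃ₗ[R] K') :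
    mult R N = mult R N' := by
  obtain ⟨e'⟩ := h.dual_schanuel (h'.comp_equiv e) hf (hf'.comp_equiv e)
  have h1 := mult_congr hKRS e'
  rwa [mult_prod hKRS, mult_prod hKRS, mult_of_projective hKRS ‹Module.Projective R P'›,
    mult_of_projective hKRS ‹Module.Projective R P›, add_zero, add_zero] at h1

/-- `omega` is prescribed on basis elements only. Schanuel makes the multiplicities of a syzygy
independent of the cover, and a product of covers is a cover of the product, so both sides are
additive; they vanish on projectives. -/
theorem mult_syz (hKRS : HasKrullRemakSchmidt R) (M : Type u) [AddCommGroup M] [Module R M]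
    [Module.Finite R M] : mult R (Syz R M) = omega R (mult R M) := by
  have hproj : ∀ (M : Type u) [AddCommGroup M] [Module R M] [Module.Finite R M],
      Module.Projective R M → mult R (Syz R M) = omega R (mult R M) := by
    intro M _ _ _ h
    obtain ⟨e⟩ := (isShortExact_syz (R := R) M).nonempty_equiv_of_projective
    rw [mult_of_projective hKRS h, map_zero,
      mult_of_projective hKRS (projective_left_of_equiv_prod e)]
  refine finite_module_induction (R := R)
    (motive := fun M _ _ _ => mult R (Syz R M) = omega R (mult R M))
    ?equiv ?subsingleton ?indecomposable ?prod M
  case equiv =>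
    intro M N _ _ _ _ _ _ e h
    rw [← mult_congr hKRS e, ← h]
    exact ((isShortExact_syz M).mult_eq_mult hKRS (isShortExact_syz N) e).symm
  case subsingleton => exact fun M _ _ _ _ => hproj M inferInstance
  case indecomposable =>
    intro M _ _ _ h
    by_cases hp : Module.Projective R M
    · exact hproj M hp
    · rw [mult_of_indecomposable hKRS h hp, omega_single]
      obtain ⟨e⟩ := isoClass_eq_iff.1 (isoClass_out (isoClass R M)).symm
      exact (isShortExact_syz M).mult_eq_mult hKRS (isShortExact_syz _) e
  case prod =>
    intro M N _ _ _ _ _ _ hM hN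
    rw [mult_prod hKRS, map_add, ← hM, ← hN, ← mult_prod hKRS]
    exact (isShortExact_syz _).mult_eq_mult hKRS
      ((isShortExact_syz M).prodMap (isShortExact_syz N)) (LinearEquiv.refl R _)

theorem IsShortExact.mult_eq_omega [Module.Finite R K] [Module.Finite R N]
    (hKRS : HasKrullRemakSchmidt R) {f : K →ₗ[R] P}
    {g : P →ₗ[R] N} (h : IsShortExact f g) : mult R K = omega R (mult R N) := by
  rw [← mult_syz hKRS, h.mult_eq_mult hKRS (isShortExact_syz N) (LinearEquiv.refl R N)]

theorem eq_zero_of_add_eq_single {ι : Type*} {x y : ι →₀ ℤ} {c : ι} (hx : 0 ≤ x) (hy : 0 ≤ y)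
    (h : x + y = Finsupp.single c 1) (hx0 : x ≠ 0) : y = 0 := by
  have hd : ∀ d, d ≠ c → x d = 0 ∧ y d = 0 := by
    intro d hd
    have h1 := DFunLike.congr_fun h d
    rw [Finsupp.add_apply, Finsupp.single_eq_of_ne hd] at h1
    have h2 : 0 ≤ x d := hx d
    have h3 : 0 ≤ y d := hy d
    lia
  have hc := DFunLike.congr_fun h c
  rw [Finsupp.add_apply, Finsupp.single_eq_same] at hc
  have hxc : x c ≠ 0 := by
    intro h0
    refine hx0 (Finsupp.ext fun d => ?_)
    by_cases hdc : d = c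
    · rw [hdc, h0, Finsupp.zero_apply]
    · exact (hd d hdc).1
  have h2 : 0 ≤ x c := hx c
  have h3 : 0 ≤ y c := hy c
  refine Finsupp.ext fun d => ?_
  by_cases hdc : d = c
  · rw [hdc, Finsupp.zero_apply]
    lia
  · exact (hd d hdc).2

/-- The syzygy of an indecomposable nonprojective module `N` with vanishing `Ext^i(N, R)` is the
direct sum of a module with the same properties and a projective module. -/
theorem IsShortExact.exists_stable_summand [Module.Finite R K] [Module.Finite R N]
    (hKRS : HasKrullRemakSchmidt R)
    (hN : IsStableIndecomposable R N) {f : K →ₗ[R] P} {g : P →ₗ[R] N} (h : IsShortExact f g) :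
    ∃ (C F : Type u) (_ : AddCommGroup C) (_ : Module R C) (_ : Module.Finite R C)
      (_ : AddCommGroup F) (_ : Module R F) (_ : Module.Finite R F),
      IsStableIndecomposable R C ∧ Module.Projective R F ∧ Nonempty (K ≃ₗ[R] C × F) := by
  have hf := hN.ext_vanishes.formsExtend h
  -- If `K` were projective, its identity would extend to `P`, the sequence would split and `N`
  -- would be projective.
  have hK : mult R K ≠ 0 := by
    intro h0
    have := projective_of_mult_eq_zero hKRS h0
    obtain ⟨r, hr⟩ := hf.exists_extension LinearMap.id
    obtain ⟨e⟩ := h.nonempty_equiv_of_retraction hr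
    exact hN.not_projective (projective_right_of_equiv_prod e)
  obtain ⟨c, hc⟩ := DFunLike.ne_iff.1 hK
  obtain ⟨C, F, _, _, _, _, _, _, -, hC, hCp, ⟨e⟩⟩ := exists_summand_of_mem_support hKRS hc
  have hE := hf.comp_equiv e.symm
  have hS := h.comp_equiv e.symm
  -- Embed `C` and `F` separately into `P`. By dual Schanuel the multiplicities of the two cokernels
  -- add up to those of the indecomposable `N`, so one cokernel is projective. It is not that of
  -- `C`, since `C` would then be projective; so it is that of `F`, and `F` is projective.
  have h1 := isShortExact_mkQ (f := (f ∘ₗ e.symm.toLinearMap) ∘ₗ LinearMap.inl R C F)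
    (hS.injective.comp LinearMap.inl_injective)
  have h2 := isShortExact_mkQ (f := (f ∘ₗ e.symm.toLinearMap) ∘ₗ LinearMap.inr R C F)
    (hS.injective.comp LinearMap.inr_injective)
  have hm := hS.mult_eq_mult_of_formsExtend hKRS (h1.prodMap h2) hE
    (hE.comp_inl.prodMap hE.comp_inr) (LinearEquiv.refl R _)
  rw [mult_of_indecomposable hKRS hN.indecomposable hN.not_projective, mult_prod hKRS] at hm
  have h3 := eq_zero_of_add_eq_single (mult_nonneg _) (mult_nonneg _) hm.symm (by
    intro h0
    have := projective_of_mult_eq_zero hKRS h0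
    obtain ⟨e'⟩ := h1.nonempty_equiv_of_projective
    exact hCp (projective_left_of_equiv_prod e'))
  have := projective_of_mult_eq_zero hKRS h3
  obtain ⟨e'⟩ := h2.nonempty_equiv_of_projective
  refine ⟨C, F, _, _, ‹_›, _, _, ‹_›, ⟨hC, hCp, ?_⟩, projective_left_of_equiv_prod e', ⟨e⟩⟩
  refine (ExtVanishesFrom.syzygy h le_rfl fun i hi => hN.ext_vanishes i (by lia)).of_retract
    (e.symm.toLinearMap ∘ₗ LinearMap.inl R C F) (LinearMap.fst R C F ∘ₗ e.toLinearMap) ?_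
  ext
  simp

theorem exists_omega_single_eq (hKRS : HasKrullRemakSchmidt R) {c : FGClass R}
    (hc : c ∈ stableClasses R) :
    ∃ c' ∈ stableClasses R, omega R (Finsupp.single c 1) = Finsupp.single c' 1 := by
  obtain ⟨C, F, _, _, _, _, _, _, hC, hF, ⟨e⟩⟩ :=
    (isShortExact_syz (R := R) c.out).exists_stable_summand hKRS hc
  refine ⟨isoClass R C, isoClass_mem_stableClasses hC, ?_⟩
  rw [omega_single, mult_congr hKRS e, mult_prod hKRS, mult_of_projective hKRS hF, add_zero,
    mult_of_indecomposable hKRS hC.indecomposable hC.not_projective]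

/-- Dual Schanuel recovers a stable indecomposable from its syzygy, even when the syzygy is known
only up to projective summands. -/
theorem omega_single_injective (hKRS : HasKrullRemakSchmidt R) {c d : FGClass R}
    (hc : c ∈ stableClasses R) (hd : d ∈ stableClasses R)
    (h : omega R (Finsupp.single c 1) = omega R (Finsupp.single d 1)) : c = d := by
  have h1 := isShortExact_syz (R := R) c.out
  have h2 := isShortExact_syz (R := R) d.out
  obtain ⟨C, F, _, _, _, _, _, _, hC, hF, ⟨e⟩⟩ := h1.exists_stable_summand hKRS hc
  obtain ⟨D, G, _, _, _, _, _, _, hD, hG, ⟨e'⟩⟩ := h2.exists_stable_summand hKRS hd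
  rw [omega_single, omega_single, mult_congr hKRS e, mult_congr hKRS e', mult_prod hKRS,
    mult_prod hKRS, mult_of_projective hKRS hF, mult_of_projective hKRS hG, add_zero, add_zero,
    mult_of_indecomposable hKRS hC.indecomposable hC.not_projective,
    mult_of_indecomposable hKRS hD.indecomposable hD.not_projective,
    Finsupp.single_left_inj one_ne_zero, isoClass_eq_iff] at h
  obtain ⟨k⟩ := h
  -- The syzygies `C × F` and `D × G` agree only up to `F` and `G`. Adding the identity sequences of
  -- `G` and of `F` makes the left-hand terms isomorphic without changing the cokernels.
  have hid : ∀ F : Type u, [AddCommGroup F] → [Module R F] →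
      IsShortExact (LinearMap.id : F →ₗ[R] F) (0 : F →ₗ[R] PUnit.{u + 1}) := fun F _ _ =>
    ⟨Function.injective_id, fun x => by simp, fun x => ⟨0, rfl⟩⟩
  have hm := (h1.prodMap (hid G)).mult_eq_mult_of_formsExtend hKRS (h2.prodMap (hid F))
    ((hc.ext_vanishes.formsExtend h1).prodMap formsExtend_id)
    ((hd.ext_vanishes.formsExtend h2).prodMap formsExtend_id)
    ((e.prodCongr (LinearEquiv.refl R G)).trans (LinearEquiv.trans
      ((LinearEquiv.prodAssoc R C F G).trans (LinearEquiv.trans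
        (k.prodCongr (LinearEquiv.prodComm R F G)) (LinearEquiv.prodAssoc R D G F).symm))
      (e'.symm.prodCongr (LinearEquiv.refl R F))))
  rw [mult_congr hKRS (LinearEquiv.prodUnique (R := R) (M := c.out) (M₂ := PUnit.{u + 1})),
    mult_congr hKRS (LinearEquiv.prodUnique (R := R) (M := d.out) (M₂ := PUnit.{u + 1})),
    mult_of_indecomposable hKRS hc.indecomposable hc.not_projective,
    mult_of_indecomposable hKRS hd.indecomposable hd.not_projective,
    Finsupp.single_left_inj one_ne_zero, isoClass_out, isoClass_out] at hm
  exact hm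

end Syzygy

/-! ### Combinatorics of injective self-maps -/

section Periodic

variable {ι : Type*} {θ : ι → ι} {S : Set ι}

theorem iterate_mem_periodicPts {b : ι} (hb : b ∈ Function.periodicPts θ) (j : ℕ) :
    θ^[j] b ∈ Function.periodicPts θ := by
  obtain ⟨n, hn, h⟩ := hb
  exact ⟨n, hn, h.map (Function.Commute.iterate_self θ j).semiconj⟩

/-- A finite set with a nonperiodic point of `θ` has a nonperiodic point that does not lie on the
forward orbit of another nonperiodic point of the set. -/
theorem exists_nonperiodic_minimal (A : Finset ι) (hA : ∃ b ∈ A, b ∉ Function.periodicPts θ) :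
    ∃ b ∈ A, b ∉ Function.periodicPts θ ∧ ∀ b' ∈ A, ∀ j, 0 < j → θ^[j] b' ≠ b := by
  let A' := {b : A // (b : ι) ∉ Function.periodicPts θ}
  -- Nonperiodicity makes this transitive relation irreflexive, hence well-founded on a finite set.
  let rel : A' → A' → Prop := fun x y => ∃ j, 0 < j ∧ θ^[j] x.1.1 = y.1.1
  have : IsTrans A' rel := ⟨fun x y z ⟨j, hj, hxy⟩ ⟨k, hk, hyz⟩ =>
    ⟨k + j, by lia, by rw [Function.iterate_add_apply, hxy, hyz]⟩⟩
  have : Std.Irrefl rel := ⟨fun x ⟨j, hj, h⟩ => x.2 ⟨j, hj, h⟩⟩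
  obtain ⟨b, hb, hb'⟩ := hA
  obtain ⟨m, -, hm⟩ := (Finite.wellFounded_of_trans_of_irrefl rel).has_min Set.univ
    ⟨⟨⟨b, hb⟩, hb'⟩, trivial⟩
  refine ⟨m.1.1, m.1.2, m.2, fun b' hb' j hj h => ?_⟩
  by_cases hp : b' ∈ Function.periodicPts θ
  · exact m.2 (h ▸ iterate_mem_periodicPts hp j)
  · exact hm ⟨⟨b', hb'⟩, hp⟩ trivial ⟨j, hj, h⟩

/-- If a nontrivial combination of the shifts of `x` along an injective self-map vanishes, then
`x` is supported on periodic points. -/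
theorem mem_periodicPts_of_sum_eq_zero (hθ : Set.MapsTo θ S S) (hinj : Set.InjOn θ S)
    {x : ι →₀ ℤ} (hx : ↑x.support ⊆ S) {r : ℤ →₀ ℤ} (hr : r ≠ 0) {n : ℤ}
    (hn : ∀ a ∈ r.support, a ≤ n)
    (h : (r.sum fun a z => z • x.mapDomain θ^[(n - a).toNat]) = 0) {b : ι} (hb : b ∈ x.support) :
    b ∈ Function.periodicPts θ := by
  classical
  by_contra hbp
  obtain ⟨b, hb, hbp, hmin⟩ := exists_nonperiodic_minimal x.support ⟨b, hb, hbp⟩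
  have hne := Finsupp.support_nonempty_iff.2 hr
  set a₀ := r.support.max' hne with ha₀
  have ha₀m : a₀ ∈ r.support := Finset.max'_mem _ _
  have hinj' : ∀ m, Set.InjOn θ^[m] S := fun m => hinj.iterate hθ m
  -- At this point only the top exponent `a₀` contributes. A contribution of `b'` from `a < a₀`
  -- would give `θ^[a₀ - a] b' = b` by injectivity, against the choice of `b`.
  have h1 := DFunLike.congr_fun h (θ^[(n - a₀).toNat] b)
  rw [Finsupp.sum, Finsupp.finsetSum_apply, Finset.sum_eq_single a₀] at h1
  · rw [Finsupp.smul_apply, Finsupp.mapDomain_apply' S x hx (hinj' _) (hx hb), smul_eq_mul,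
      Finsupp.zero_apply, mul_eq_zero] at h1
    exact h1.elim (Finsupp.mem_support_iff.1 ha₀m) (Finsupp.mem_support_iff.1 hb)
  · intro a ha hne'
    have hlt : a < a₀ := lt_of_le_of_ne (Finset.le_max' _ _ ha) hne'
    have hle := hn a₀ ha₀m
    rw [Finsupp.smul_apply, smul_eq_zero]
    right
    by_contra hc
    obtain ⟨b', hb', hbb⟩ := Finset.mem_image.1
      (Finsupp.mapDomain_support (Finsupp.mem_support_iff.2 hc))
    rw [show (n - a).toNat = (n - a₀).toNat + (a₀ - a).toNat by lia,
      Function.iterate_add_apply] at hbb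
    exact hmin b' hb' _ (by lia) (hinj' _ (hθ.iterate _ (hx hb')) (hx hb) hbb)
  · exact fun h => absurd ha₀m h

end Periodic

/-! ### Classes in `J(R)` and detection of relations -/

section Classes

variable {R : Type u} [CommRing R]

theorem basisElt_eq_single (M : Type u) [AddCommGroup M] [Module R M] [Module.Finite R M] :
    basisElt R M = Finsupp.single (isoClass R M) 1 := rfl

variable {K P N : Type u} [AddCommGroup K] [Module R K] [Module.Finite R K]
  [AddCommGroup P] [Module R P] [Module.Finite R P]
  [AddCommGroup N] [Module R N] [Module.Finite R N]

theorem cls_congr (e : K ≃ₗ[R] N) : cls R K = cls R N := by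
  rw [cls, cls, basisElt_eq_single, basisElt_eq_single, isoClass_eq_iff.2 ⟨e⟩]

theorem cls_prod : cls R (K × N) = cls R K + cls R N := by
  have h : basisElt R (K × N) - basisElt R K - basisElt R N ∈ relations R :=
    Submodule.subset_span (.directSum K N)
  rw [sub_sub] at h
  exact (Submodule.Quotient.eq _).2 h

theorem IsShortExact.cls_eq [Module.Projective R P] {f : K →ₗ[R] P} {g : P →ₗ[R] N}
    (h : IsShortExact f g) : cls R N = (LaurentPolynomial.T 1 : ℤ[T;T⁻¹]) • cls R K :=
  (Submodule.Quotient.eq _).2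
    (Submodule.subset_span (.syzygy K P N f g h.injective h.exact h.surjective))

/-- Additivity gives `[0] = 0`, and the sequence `0 → P → P → 0 → 0` gives `[P] = [0]`. -/
theorem cls_of_projective [Module.Projective R P] : cls R P = 0 := by
  have h : cls R P = cls R (P × PUnit.{u + 1}) :=
    cls_congr (LinearEquiv.prodUnique (R := R) (M := P) (M₂ := PUnit.{u + 1})).symm
  have h0 : cls R PUnit.{u + 1} = 0 := by
    rwa [cls_prod, left_eq_add] at h
  have h1 : basisElt R P - basisElt R PUnit.{u + 1} ∈ relations R :=
    Submodule.subset_span (.projSub P P PUnit LinearMap.id 0 Function.injective_id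
      (fun x => by simp) fun x => ⟨0, rfl⟩)
  exact ((Submodule.Quotient.eq _).2 h1).trans h0

/-- The element of `J(R)` given by an integral combination of isomorphism classes. -/
noncomputable def toJ (R : Type u) [CommRing R] : (FGClass R →₀ ℤ) →ₗ[ℤ] J R :=
  Finsupp.linearCombination ℤ fun c => cls R c.out

/-- A preimage in the free module of the element of `J(R)` given by an integral combination of
classes. -/
noncomputable def toFree (R : Type u) [CommRing R] :
    (FGClass R →₀ ℤ) →ₗ[ℤ] FreeOnClasses R :=
  Finsupp.linearCombination ℤ fun c => basisElt R c.out

theorem mk_toFree (x : FGClass R →₀ ℤ) :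
    (Submodule.Quotient.mk (toFree R x) : J R) = toJ R x := by
  induction x using Finsupp.induction_linear with
  | zero => simp
  | add x y hx hy => rw [map_add, map_add, Submodule.Quotient.mk_add, hx, hy]
  | single c z => simp [toFree, toJ, cls]

theorem cls_isoClass_out (M : Type u) [AddCommGroup M] [Module R M] [Module.Finite R M] :
    cls R (isoClass R M).out = cls R M := by
  obtain ⟨e⟩ := isoClass_eq_iff.1 (isoClass_out (isoClass R M))
  exact cls_congr e

variable [IsNoetherianRing R]

theorem cls_eq_toJ_mult (hKRS : HasKrullRemakSchmidt R) (M : Type u) [AddCommGroup M] [Module R M]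
    [Module.Finite R M] : cls R M = toJ R (mult R M) := by
  refine finite_module_induction (R := R)
    (motive := fun M _ _ _ => cls R M = toJ R (mult R M))
    ?equiv ?subsingleton ?indecomposable ?prod M
  case equiv =>
    intro M N _ _ _ _ _ _ e h
    rw [← mult_congr hKRS e, ← h, cls_congr e]
  case subsingleton =>
    intro M _ _ _ _
    rw [mult_of_subsingleton hKRS, map_zero, cls_of_projective]
  case indecomposable =>
    intro M _ _ _ h
    by_cases hp : Module.Projective R M
    · rw [mult_of_projective hKRS hp, map_zero, cls_of_projective]
    · rw [mult_of_indecomposable hKRS h hp]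
      simp [toJ, cls_isoClass_out]
  case prod =>
    intro M N _ _ _ _ _ _ hM hN
    rw [mult_prod hKRS, map_add, cls_prod, hM, hN]

/-- On basis elements this is the syzygy relation for the chosen cover. -/
theorem toJ_eq_smul_toJ_omega (hKRS : HasKrullRemakSchmidt R) (x : FGClass R →₀ ℤ) :
    toJ R x = (LaurentPolynomial.T 1 : ℤ[T;T⁻¹]) • toJ R (omega R x) := by
  induction x using Finsupp.induction_linear with
  | zero => simp
  | add x y hx hy => rw [map_add, map_add, map_add, smul_add, ← hx, ← hy]
  | single c z =>
    rw [← mul_one z, ← smul_eq_mul, ← Finsupp.smul_single, map_smul, map_smul, map_smul,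
      omega_single, ← cls_eq_toJ_mult hKRS, smul_comm, ← (isShortExact_syz (R := R) c.out).cls_eq]
    simp [toJ]

theorem toJ_eq_smul_toJ_omega_pow (hKRS : HasKrullRemakSchmidt R) (x : FGClass R →₀ ℤ) (n : ℕ) :
    toJ R x = (LaurentPolynomial.T n : ℤ[T;T⁻¹]) • toJ R ((omega R ^ n) x) := by
  induction n with
  | zero => simp
  | succ n ih =>
    rw [ih, toJ_eq_smul_toJ_omega hKRS ((omega R ^ n) x), smul_smul, ← LaurentPolynomial.T_add,
      pow_succ', Module.End.mul_apply, Nat.cast_succ]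

/-- The additive map that sends `t ^ a [M]` to the multiplicities of the `(n - a)`-th syzygy of
`M`, for `n ≥ a`. -/
noncomputable def syzMult (R : Type u) [CommRing R] [IsNoetherianRing R] (n : ℤ) :
    FreeOnClasses R →+ (FGClass R →₀ ℤ) :=
  Finsupp.liftAddHom fun c =>
    (Finsupp.liftAddHom fun a : ℤ => (zmultiplesHom _)
      -- For `n < a` the exponent is truncated to `0`; this is harmless, since the maps are only
      -- used for large `n`.
      ((omega R ^ (n - a).toNat) (mult R c.out))).comp
        (AddMonoidAlgebra.coeffAddEquiv (R := ℤ) (M := ℤ)).toAddMonoidHom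

theorem syzMult_single (n : ℤ) (c : FGClass R) (z a : ℤ) :
    syzMult R n (Finsupp.single c (LaurentPolynomial.C z * LaurentPolynomial.T a)) =
      z • (omega R ^ (n - a).toNat) (mult R c.out) := by
  rw [← LaurentPolynomial.single_eq_C_mul_T, syzMult, Finsupp.liftAddHom_apply_single]
  change Finsupp.liftAddHom _ (Finsupp.single a z) = _
  rw [Finsupp.liftAddHom_apply_single, zmultiplesHom_apply]

theorem syzMult_smul (n : ℤ) (z a : ℤ) (x : FreeOnClasses R) :
    syzMult R n ((LaurentPolynomial.C z * LaurentPolynomial.T a : ℤ[T;T⁻¹]) • x) =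
      z • syzMult R (n - a) x := by
  induction x using Finsupp.induction_linear with
  | zero => simp
  | add x y hx hy => rw [smul_add, map_add, map_add, smul_add, hx, hy]
  | single c f =>
    induction f using LaurentPolynomial.induction_on' with
    | add f g hf hg => rw [Finsupp.single_add, smul_add, map_add, map_add, smul_add, hf, hg]
    | C_mul_T b w =>
      rw [Finsupp.smul_single, smul_eq_mul, mul_mul_mul_comm, ← map_mul, ← LaurentPolynomial.T_add,
        syzMult_single, syzMult_single, smul_smul, sub_sub]

theorem syzMult_basisElt (hKRS : HasKrullRemakSchmidt R) (n : ℤ) (M : Type u) [AddCommGroup M]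
    [Module R M] [Module.Finite R M] :
    syzMult R n (basisElt R M) = (omega R ^ n.toNat) (mult R M) := by
  obtain ⟨e⟩ := isoClass_eq_iff.1 (isoClass_out (isoClass R M))
  have h := syzMult_single n (isoClass R M) 1 0
  rwa [map_one, LaurentPolynomial.T_zero, mul_one, one_smul, sub_zero, mult_congr hKRS e] at h

/-- Composing the cover of `M` with `g` gives a cover of `M'`. Lifting `f` through the cover of `M`
identifies its kernel with the syzygy of `M` plus `P`, and `P` does not count. -/
theorem IsShortExact.omega_mult_eq (hKRS : HasKrullRemakSchmidt R) {P M M' : Type u}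
    [AddCommGroup P] [Module R P] [Module.Finite R P] [Module.Projective R P]
    [AddCommGroup M] [Module R M] [Module.Finite R M]
    [AddCommGroup M'] [Module R M'] [Module.Finite R M']
    {f : P →ₗ[R] M} {g : M →ₗ[R] M'} (h : IsShortExact f g) :
    omega R (mult R M) = omega R (mult R M') := by
  have hp := isShortExact_syz (R := R) M
  obtain ⟨s, hs⟩ := Module.projective_lifting_property (cover R M) f hp.surjective
  have hs' : ∀ x, cover R M (s x) = f x := LinearMap.congr_fun hs
  have h' : IsShortExact ((LinearMap.ker (cover R M)).subtype.coprod s) (g ∘ₗ cover R M) := by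
    refine ⟨?_, fun x => ⟨fun hx => ?_, ?_⟩, h.surjective.comp hp.surjective⟩
    · rw [← LinearMap.ker_eq_bot, LinearMap.ker_eq_bot']
      rintro ⟨k, x⟩ hx
      rw [LinearMap.coprod_apply, Submodule.subtype_apply] at hx
      have h1 := congrArg (cover R M) hx
      rw [map_add, hs', k.2, zero_add, map_zero] at h1
      obtain rfl := h.injective (h1.trans (map_zero f).symm)
      rw [map_zero, add_zero] at hx
      rw [Prod.mk_eq_zero]
      exact ⟨Subtype.ext hx, rfl⟩
    · obtain ⟨y, hy⟩ := (h.exact _).1 hx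
      refine ⟨(⟨x - s y, ?_⟩, y), ?_⟩
      · rw [LinearMap.mem_ker, map_sub, hs', hy, sub_self]
      · simp
    · rintro ⟨⟨k, y⟩, rfl⟩
      rw [LinearMap.coprod_apply, Submodule.subtype_apply, LinearMap.comp_apply, map_add, hs', k.2,
        zero_add]
      exact (h.exact _).2 ⟨y, rfl⟩
  rw [← h'.mult_eq_omega hKRS, mult_prod hKRS, mult_of_projective hKRS ‹Module.Projective R P›,
    add_zero, mult_syz hKRS]

/-- Multiplication by `t ^ a` shifts the index `n` by `a`, so no single `n` works for the whole
submodule and the vanishing is only eventual. -/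
theorem eventually_syzMult_eq_zero (hKRS : HasKrullRemakSchmidt R) {x : FreeOnClasses R}
    (hx : x ∈ relations R) : ∀ᶠ n in Filter.atTop, syzMult R n x = 0 := by
  induction hx using Submodule.span_induction with
  | zero => simp
  | add x y _ _ hx hy =>
    filter_upwards [hx, hy] with n h1 h2
    rw [map_add, h1, h2, add_zero]
  | smul r x _ hx =>
    induction r using LaurentPolynomial.induction_on' with
    | add f g hf hg =>
      filter_upwards [hf, hg] with n h1 h2
      rw [add_smul, map_add, h1, h2, add_zero]
    | C_mul_T a z =>
      have ht : Filter.Tendsto (fun n : ℤ => n - a) Filter.atTop Filter.atTop :=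
        Filter.tendsto_atTop_add_const_right _ (-a) Filter.tendsto_id
      filter_upwards [ht.eventually hx] with n h
      rw [syzMult_smul, h, smul_zero]
  | mem x hx =>
    -- With `n ≥ 1` at least one syzygy is taken; the first two kinds of generators need it.
    filter_upwards [Filter.eventually_ge_atTop 1] with n hn
    cases hx with
    | projSub P M M' f g hf hfg hg =>
      have h : IsShortExact f g := ⟨hf, hfg, hg⟩
      rw [map_sub, syzMult_basisElt hKRS, syzMult_basisElt hKRS,
        show n.toNat = (n - 1).toNat + 1 by lia, pow_succ, Module.End.mul_apply,
        Module.End.mul_apply, h.omega_mult_eq hKRS, sub_self]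
    | syzygy M' P M f g hf hfg hg =>
      have h : IsShortExact f g := ⟨hf, hfg, hg⟩
      have h1 := syzMult_smul n 1 1 (basisElt R M')
      rw [map_one, one_mul, one_smul] at h1
      rw [map_sub, h1, syzMult_basisElt hKRS, syzMult_basisElt hKRS, h.mult_eq_omega hKRS,
        ← Module.End.mul_apply, ← pow_succ, show (n - 1).toNat + 1 = n.toNat by lia, sub_self]
    | directSum M M' =>
      rw [map_sub, map_sub, syzMult_basisElt hKRS, syzMult_basisElt hKRS, syzMult_basisElt hKRS,
        mult_prod hKRS, map_add, add_sub_cancel_left, sub_self]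

end Classes

/-! ### Stable representatives and periodicity of torsion elements -/

section Torsion

variable {R : Type u} [CommRing R] [IsNoetherianRing R]

theorem support_mult_subset (hKRS : HasKrullRemakSchmidt R) {M : Type u} [AddCommGroup M]
    [Module R M] [Module.Finite R M] (hM : ExtVanishesFrom R M 1) :
    ↑(mult R M).support ⊆ stableClasses R := by
  intro c hc
  obtain ⟨C, F, _, _, _, _, _, _, rfl, hC, hCp, ⟨e⟩⟩ :=
    exists_summand_of_mem_support hKRS (Finsupp.mem_support_iff.1 hc)
  exact isoClass_mem_stableClasses ⟨hC, hCp, hM.of_retract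
    (e.symm.toLinearMap ∘ₗ LinearMap.inl R C F) (LinearMap.fst R C F ∘ₗ e.toLinearMap)
    (by ext; simp)⟩

/-- Each syzygy lowers the Ext bound by one and costs a factor `t`; after `n` of them all
nonprojective indecomposable summands are stable. -/
theorem exists_cls_eq_smul_toJ_of_extVanishesFrom (hKRS : HasKrullRemakSchmidt R) (n : ℕ)
    (M : Type u) [AddCommGroup M] [Module R M] [Module.Finite R M]
    (hM : ExtVanishesFrom R M (n + 1)) :
    ∃ x : FGClass R →₀ ℤ, ↑x.support ⊆ stableClasses R ∧
      cls R M = (LaurentPolynomial.T n : ℤ[T;T⁻¹]) • toJ R x := by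
  induction n generalizing M with
  | zero => exact ⟨mult R M, support_mult_subset hKRS hM, by simp [cls_eq_toJ_mult hKRS]⟩
  | succ n ih =>
    obtain ⟨x, hx, h⟩ := ih (Syz R M) (hM.syzygy (isShortExact_syz M) (by lia))
    refine ⟨x, hx, ?_⟩
    rw [(isShortExact_syz M).cls_eq, h, smul_smul, ← LaurentPolynomial.T_add, Nat.cast_succ,
      add_comm]

theorem exists_stable_map (hKRS : HasKrullRemakSchmidt R) :
    ∃ θ : FGClass R → FGClass R, Set.MapsTo θ (stableClasses R) (stableClasses R) ∧
      Set.InjOn θ (stableClasses R) ∧ ∀ x : FGClass R →₀ ℤ, ↑x.support ⊆ stableClasses R →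
        ∀ n : ℕ, (omega R ^ n) x = x.mapDomain θ^[n] := by
  classical
  choose θ hθ hω using fun c (hc : c ∈ stableClasses R) => exists_omega_single_eq hKRS hc
  -- The value off the stable classes is arbitrary; it only makes the map total.
  let θ' : FGClass R → FGClass R := fun c => if hc : c ∈ stableClasses R then θ c hc else c
  have hθ' : ∀ c (hc : c ∈ stableClasses R), θ' c = θ c hc := fun c hc => dif_pos hc
  have hmaps : Set.MapsTo θ' (stableClasses R) (stableClasses R) := fun c hc => by
    rw [hθ' c hc]
    exact hθ c hc
  have hω' : ∀ c ∈ stableClasses R, omega R (Finsupp.single c 1) = Finsupp.single (θ' c) 1 :=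
    fun c hc => by rw [hω c hc, hθ' c hc]
  refine ⟨θ', hmaps, fun c hc d hd h => ?_, fun x hx n => ?_⟩
  · exact omega_single_injective hKRS hc hd (by rw [hω' c hc, hω' d hd, h])
  · have hsingle : ∀ c ∈ stableClasses R,
        (omega R ^ n) (Finsupp.single c 1) = Finsupp.single (θ'^[n] c) 1 := by
      intro c hc
      induction n with
      | zero => simp
      | succ n ih =>
        rw [pow_succ', Module.End.mul_apply, ih, hω' _ (hmaps.iterate n hc),
          Function.iterate_succ_apply']
    conv_lhs => rw [← x.sum_single]
    rw [Finsupp.mapDomain, Finsupp.sum, Finsupp.sum, map_sum]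
    refine Finset.sum_congr rfl fun c hc => ?_
    rw [← mul_one (x c), ← smul_eq_mul, ← Finsupp.smul_single, map_smul, hsingle c (hx hc),
      Finsupp.smul_single]

theorem exists_eq_smul_toJ (hKRS : HasKrullRemakSchmidt R)
    (hGor : FiniteSelfInjectiveDimension R) (u : J R) :
    ∃ (k : ℤ) (x : FGClass R →₀ ℤ), ↑x.support ⊆ stableClasses R ∧
      u = (LaurentPolynomial.T k : ℤ[T;T⁻¹]) • toJ R x := by
  classical
  obtain ⟨d, hd⟩ := hGor.exists_extVanishesFrom
  obtain ⟨θ, hmaps, -, hω⟩ := exists_stable_map hKRS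
  have hadd : ∀ u v : J R,
      (∃ (k : ℤ) (x : FGClass R →₀ ℤ), ↑x.support ⊆ stableClasses R ∧
        u = (LaurentPolynomial.T k : ℤ[T;T⁻¹]) • toJ R x) →
      (∃ (k : ℤ) (x : FGClass R →₀ ℤ), ↑x.support ⊆ stableClasses R ∧
        v = (LaurentPolynomial.T k : ℤ[T;T⁻¹]) • toJ R x) →
      ∃ (k : ℤ) (x : FGClass R →₀ ℤ), ↑x.support ⊆ stableClasses R ∧
        u + v = (LaurentPolynomial.T k : ℤ[T;T⁻¹]) • toJ R x := by
    -- Replacing `x` by `omega ^ n` of it raises the exponent by `n`, so two elements can be brought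
    -- to the common exponent `max k l` and added.
    have key : ∀ (k : ℤ) (n : ℕ) (x : FGClass R →₀ ℤ), ↑x.support ⊆ stableClasses R →
        ↑((omega R ^ n) x).support ⊆ stableClasses R ∧
          (LaurentPolynomial.T k : ℤ[T;T⁻¹]) • toJ R x =
            (LaurentPolynomial.T (k + n) : ℤ[T;T⁻¹]) • toJ R ((omega R ^ n) x) := by
      intro k n x hx
      constructor
      · rw [hω x hx n]
        intro c hc
        obtain ⟨b, hb, rfl⟩ := Finset.mem_image.1 (Finsupp.mapDomain_support hc)
        exact hmaps.iterate n (hx hb)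
      · rw [LaurentPolynomial.T_add, mul_smul, ← toJ_eq_smul_toJ_omega_pow hKRS]
    rintro _ _ ⟨k, x, hx, rfl⟩ ⟨l, y, hy, rfl⟩
    obtain ⟨hx1, hx2⟩ := key k (max k l - k).toNat x hx
    obtain ⟨hy1, hy2⟩ := key l (max k l - l).toNat y hy
    rw [show k + (max k l - k).toNat = max k l by lia] at hx2
    rw [show l + (max k l - l).toNat = max k l by lia] at hy2
    refine ⟨max k l, _, ?_, by rw [hx2, hy2, ← smul_add, ← map_add]⟩
    intro c hc
    exact (Finset.mem_union.1 (Finsupp.support_add hc)).elim (fun h => hx1 h) fun h => hy1 h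
  obtain ⟨u, rfl⟩ := Submodule.Quotient.mk_surjective _ u
  induction u using Finsupp.induction_linear with
  | zero => exact ⟨0, 0, by simp, by simp⟩
  | add u v hu hv => exact hadd _ _ hu hv
  | single c f =>
    induction f using LaurentPolynomial.induction_on' with
    | add f g hf hg =>
      rw [Finsupp.single_add]
      exact hadd _ _ hf hg
    | C_mul_T a z =>
      obtain ⟨x, hx, h⟩ := exists_cls_eq_smul_toJ_of_extVanishesFrom hKRS d c.out (hd c.out)
      refine ⟨a + d, z • x, fun b hb => hx (Finsupp.support_smul hb), ?_⟩
      rw [LaurentPolynomial.T_add, mul_smul, map_smul, smul_comm _ z, ← h, smul_comm _ z, cls,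
        basisElt_eq_single, isoClass_out, ← Submodule.Quotient.mk_smul,
        ← Submodule.Quotient.mk_smul, Finsupp.smul_single, Finsupp.smul_single, smul_eq_mul,
        mul_one, LaurentPolynomial.smul_eq_C_mul]

/-- This rewrites `r • toFree R x` as the combination of shifts to which
`mem_periodicPts_of_sum_eq_zero` applies. -/
theorem syzMult_smul_toFree (hKRS : HasKrullRemakSchmidt R) {x : FGClass R →₀ ℤ}
    (hx : ↑x.support ⊆ stableClasses R) (n : ℤ) (r : ℤ[T;T⁻¹]) :
    syzMult R n (r • toFree R x) = r.coeff.sum fun a z => z • (omega R ^ (n - a).toNat) x := by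
  induction r using LaurentPolynomial.induction_on' with
  | add f g hf hg =>
    rw [add_smul, map_add, hf, hg, AddMonoidAlgebra.coeff_add, Finsupp.sum_add_index']
    · simp
    · intro a z w
      rw [add_smul]
  | C_mul_T a z =>
    rw [syzMult_smul, ← LaurentPolynomial.single_eq_C_mul_T, AddMonoidAlgebra.coeff_single,
      Finsupp.sum_single_index (by exact zero_smul _ _)]
    congr 1
    conv_rhs => rw [← x.sum_single]
    rw [toFree, Finsupp.linearCombination_apply, Finsupp.sum, Finsupp.sum, map_sum, map_sum]
    refine Finset.sum_congr rfl fun c hc => ?_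
    have h := hx hc
    rw [map_zsmul, syzMult_basisElt hKRS,
      mult_of_indecomposable hKRS h.indecomposable h.not_projective, isoClass_out, ← map_smul,
      Finsupp.smul_single, smul_eq_mul, mul_one]

theorem T_pow_sub_one_ne_zero {n : ℕ} (hn : 0 < n) :
    (LaurentPolynomial.T 1 : ℤ[T;T⁻¹]) ^ n - 1 ≠ 0 := by
  rw [LaurentPolynomial.T_pow, mul_one, ← LaurentPolynomial.T_zero, sub_ne_zero]
  intro h
  have := congrArg (fun f : ℤ[T;T⁻¹] => f.coeff 0) h
  simp [hn.ne'] at this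

theorem exists_periodic_of_smul_eq_zero (hGor : FiniteSelfInjectiveDimension R)
    (hKRS : HasKrullRemakSchmidt R) {u : J R} {r : ℤ[T;T⁻¹]} (hr : r ≠ 0) (hu : r • u = 0) :
    ∃ (k : ℤ) (x : FGClass R →₀ ℤ) (n : ℕ), 0 < n ∧
      u = (LaurentPolynomial.T k : ℤ[T;T⁻¹]) • toJ R x ∧
      ∀ c ∈ x.support, ((LaurentPolynomial.T 1 : ℤ[T;T⁻¹]) ^ n - 1) • cls R c.out = 0 := by
  obtain ⟨k, x, hx, rfl⟩ := exists_eq_smul_toJ hKRS hGor u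
  obtain ⟨θ, hmaps, hinj, hω⟩ := exists_stable_map hKRS
  -- The unit `t ^ k` is dropped, so `r • toFree R x` itself is a relation.
  rw [smul_comm, (LaurentPolynomial.isUnit_T k).smul_eq_zero, ← mk_toFree,
    ← Submodule.Quotient.mk_smul, Submodule.Quotient.mk_eq_zero] at hu
  have hr' : r.coeff ≠ 0 := fun h => hr (LaurentPolynomial.ext fun a => by rw [h]; rfl)
  -- Choose `n` beyond every exponent of `r` as well, so that no `n - a` is truncated.
  obtain ⟨n, hn, hle⟩ := ((eventually_syzMult_eq_zero hKRS hu).and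
    ((Finset.eventually_all r.coeff.support).2 fun a _ => Filter.eventually_ge_atTop a)).exists
  rw [syzMult_smul_toFree hKRS hx] at hn
  simp only [hω x hx] at hn
  have hper : ∀ c ∈ x.support, c ∈ Function.periodicPts θ := fun c hc =>
    mem_periodicPts_of_sum_eq_zero hmaps hinj hx hr' hle hn hc
  -- The product of the minimal periods is a common period of the support.
  refine ⟨k, x, ∏ c ∈ x.support, Function.minimalPeriod θ c,
    Finset.prod_pos fun c hc => Function.minimalPeriod_pos_of_mem_periodicPts (hper c hc), rfl,
    fun c hc => ?_⟩
  have hp : θ^[∏ c ∈ x.support, Function.minimalPeriod θ c] c = c :=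
    Function.isPeriodicPt_iff_minimalPeriod_dvd.2 (Finset.dvd_prod_of_mem _ hc)
  have hc' : ↑(Finsupp.single c (1 : ℤ)).support ⊆ stableClasses R := by
    intro b hb
    rw [Finset.mem_singleton.1 (Finsupp.support_single_subset hb)]
    exact hx hc
  have h := toJ_eq_smul_toJ_omega_pow hKRS (Finsupp.single c 1)
    (∏ c ∈ x.support, Function.minimalPeriod θ c)
  rw [hω _ hc', Finsupp.mapDomain_single, hp] at h
  have hcls : toJ R (Finsupp.single c 1) = cls R c.out := by simp [toJ]
  rw [hcls] at h
  rw [LaurentPolynomial.T_pow, mul_one, sub_smul, one_smul, ← h, sub_self]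

end Torsion

end GrothendieckModule

theorem corollary5p3 (R : Type u) [CommRing R] [IsNoetherianRing R] [IsLocalRing R]
    (hGor : GrothendieckModule.FiniteSelfInjectiveDimension R)
    (hKRS : GrothendieckModule.HasKrullRemakSchmidt R) :
    (∀ x : GrothendieckModule.J R,
      (∃ r : ℤ[T;T⁻¹], r ≠ 0 ∧ r • x = 0) ↔
        ∃ n : ℕ, 0 < n ∧ ((LaurentPolynomial.T 1 : ℤ[T;T⁻¹]) ^ n - 1) • x = 0) ∧
    ((∃ x : GrothendieckModule.J R, x ≠ 0 ∧ ∃ r : ℤ[T;T⁻¹], r ≠ 0 ∧ r • x = 0) ↔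
      ∃ (M : Type u) (_ : AddCommGroup M) (_ : Module R M) (_ : Module.Finite R M),
        GrothendieckModule.cls R M ≠ 0 ∧
          ∃ r : ℤ[T;T⁻¹], r ≠ 0 ∧ r • GrothendieckModule.cls R M = 0) := by
  refine ⟨fun u => ⟨?_, ?_⟩, ⟨?_, ?_⟩⟩
  · rintro ⟨r, hr, hu⟩
    obtain ⟨k, x, n, hn, rfl, hx⟩ :=
      GrothendieckModule.exists_periodic_of_smul_eq_zero hGor hKRS hr hu
    refine ⟨n, hn, ?_⟩
    rw [smul_comm, GrothendieckModule.toJ, Finsupp.linearCombination_apply, Finsupp.sum,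
      Finset.smul_sum, Finset.sum_eq_zero, smul_zero]
    intro c hc
    rw [smul_comm, hx c hc, smul_zero]
  · rintro ⟨n, hn, hu⟩
    exact ⟨_, GrothendieckModule.T_pow_sub_one_ne_zero hn, hu⟩
  · rintro ⟨u, hu0, r, hr, hu⟩
    obtain ⟨k, x, n, hn, rfl, hx⟩ :=
      GrothendieckModule.exists_periodic_of_smul_eq_zero hGor hKRS hr hu
    -- If all classes in the support of `x` vanished, so would `toJ R x` and hence the given
    -- element.
    obtain ⟨c, hc, hc0⟩ : ∃ c ∈ x.support, GrothendieckModule.cls R c.out ≠ 0 := by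
      by_contra! h
      refine hu0 ?_
      rw [GrothendieckModule.toJ, Finsupp.linearCombination_apply, Finsupp.sum,
        Finset.sum_eq_zero, smul_zero]
      intro c hc
      rw [h c hc, smul_zero]
    exact ⟨c.out, _, _, inferInstance, hc0, _, GrothendieckModule.T_pow_sub_one_ne_zero hn,
      hx c hc⟩
  · rintro ⟨M, _, _, _, hM, hr⟩
    exact ⟨_, hM, hr⟩
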